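/- Let $a<b$ be real numbers and $n\ge 1$. Let $\mathcal P([a,b])$ be the set of Borel probability measures on $[a,b]$, and for $\mu\in\mathcal P([a,b])$ let $m_k(\mu)=\int x^k\,d\mu(x)$. Let $\mathcal M_n([a,b])=\{(m_1(\mu),\dots,m_n(\mu)):\mu\in\mathcal P([a,b])\}\subset\mathbb R^n$ be the $n$-th moment space. For $\vec m_n=(m_1,\dots,m_n)$ and $1\le k\le n$ let $m_k^-$ and $m_k^+$ be the minimum and the maximum of $m_k(\mu)$ over all $\mu\in\mathcal P([a,b])$ with $m_i(\mu)=m_i$ for $1\le i\le k-1$, and, if $m_k^-<m_k<m_k^+$, let $$p_k(\vec m_n)=\frac{m_k-m_k^-}{m_k^+-m_k^-}$$ be the $k$-th canonical moment. For $1\le k\le n$ let $f_k:(0,1)\to\mathbb R$ be a non-negative integrable function with $\int_0^1 f_k(x)\,dx>0$, and put $$f_n(\vec m_n)=\prod_{k=1}^n c_{k,n}\,f_k(p_k(\vec m_n))\,\mathbf 1_{\{m_k^-<m_k<m_k^+\}},\qquad c_{k,n}=\Bigl((b-a)^{k}\int_0^1 f_k(x)(x-x^2)^{n-k}\,dx\Bigr)^{-1}$$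 (the function $f_n$ on $\mathbb R^n$ is taken to be $0$ outside $\mathcal M_n([a,b])$; it is not to be confused with the $n$-th of the functions $f_k$). Then $f_n$ is a probability density with respect to Lebesgue measure on $\mathbb R^n$, and the distribution with density $f_n$ is concentrated on the interior of $\mathcal M_n([a,b])$. If $\vec m_n$ is a random vector with density $f_n$, then the canonical moments $p_1(\vec m_n),\dots,p_n(\vec m_n)$ are independent, and for $1\le k\le n$ the random variable $p_k(\vec m_n)$ has the density $$c_{k,n}\,(b-a)^{k}\,f_k(x)\,(x-x^2)^{n-k}\,\mathbf 1_{\{0<x<1\}}.$$ -/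

import Mathlib

open MeasureTheory ProbabilityTheory

noncomputable section

namespace CanonicalMoments

/-- The probability measures on (the Borel field of) `T ⊆ ℝ` with existing moments, regarded as
measures on `ℝ` that give no mass to the complement of `T`. -/
def momentMeasures (T : Set ℝ) : Set (Measure ℝ) :=
  {μ | IsProbabilityMeasure μ ∧ μ Tᶜ = 0 ∧ ∀ k : ℕ, Integrable (fun x : ℝ => x ^ k) μ}

/-- The `k`-th moment of `μ`. -/
def moment (μ : Measure ℝ) (k : ℕ) : ℝ := ∫ x, x ^ k ∂μ

/-- The `n`-th moment space of `T`. The coordinate with index `i : Fin n` is the moment of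
order `i + 1`. -/
def momentSpace (T : Set ℝ) (n : ℕ) : Set (Fin n → ℝ) :=
  {m | ∃ μ ∈ momentMeasures T, ∀ i : Fin n, m i = moment μ (i + 1)}

/-- The possible values of the moment of order `i + 1`, over all measures on `T` whose moments of
order `1, …, i` are those listed in `m`. -/
def possibleMoments (T : Set ℝ) {n : ℕ} (m : Fin n → ℝ) (i : Fin n) : Set ℝ :=
  {y | ∃ μ ∈ momentMeasures T, (∀ j : Fin n, j < i → moment μ (j + 1) = m j) ∧
    y = moment μ (i + 1)}

/-- The lower bound `m_k⁻`, `k = i + 1`. For `T` compact and `m_1, …, m_{k-1}` moments of a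
measure on `T`, the infimum is a minimum. -/
def lowerMoment (T : Set ℝ) {n : ℕ} (m : Fin n → ℝ) (i : Fin n) : ℝ :=
  sInf (possibleMoments T m i)

/-- The upper bound `m_k⁺`, `k = i + 1`. For `T` compact and `m_1, …, m_{k-1}` moments of a
measure on `T`, the supremum is a maximum. -/
def upperMoment (T : Set ℝ) {n : ℕ} (m : Fin n → ℝ) (i : Fin n) : ℝ :=
  sSup (possibleMoments T m i)

/-- The canonical moment `p_k = (m_k - m_k⁻) / (m_k⁺ - m_k⁻)`, `k = i + 1`. -/
def canonicalMoment (T : Set ℝ) {n : ℕ} (m : Fin n → ℝ) (i : Fin n) : ℝ :=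
  (m i - lowerMoment T m i) / (upperMoment T m i - lowerMoment T m i)

/-- The normalizing constant `c_{k,n} = ((b - a)^k ∫₀¹ f_k(x) (x - x²)^{n-k} dx)⁻¹`. -/
def normConst (a b : ℝ) (n : ℕ) (f : ℕ → ℝ → ℝ) (k : ℕ) : ℝ :=
  ((b - a) ^ k * ∫ x in Set.Ioo (0 : ℝ) 1, f k x * (x - x ^ 2) ^ (n - k))⁻¹

open Classical in
/-- The product-form density
`f_n(m) = ∏_{k=1}^n c_{k,n} f_k(p_k(m)) 1{m_k⁻ < m_k < m_k⁺}`, with `k = i + 1`. -/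
def momentDensity (a b : ℝ) (n : ℕ) (f : ℕ → ℝ → ℝ) (m : Fin n → ℝ) : ℝ :=
  ∏ i : Fin n, normConst a b n f (i + 1) *
    (if lowerMoment (Set.Icc a b) m i < m i ∧ m i < upperMoment (Set.Icc a b) m i then
      f (i + 1) (canonicalMoment (Set.Icc a b) m i) else 0)

/-- The measure on `ℝⁿ` with Lebesgue density `f_n`. -/
def momentLaw (a b : ℝ) (n : ℕ) (f : ℕ → ℝ → ℝ) : Measure (Fin n → ℝ) :=
  volume.withDensity fun m => ENNReal.ofReal (momentDensity a b n f m)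

/-- The function
`c_{k,n} (b - a)^k f_k(x) (x - x²)^{n-k} 1{0 < x < 1}`. -/
def canonicalDensity (a b : ℝ) (n : ℕ) (f : ℕ → ℝ → ℝ) (k : ℕ) : ℝ → ℝ :=
  (Set.Ioo (0 : ℝ) 1).indicator fun x =>
    normConst a b n f k * (b - a) ^ k * f k x * (x - x ^ 2) ^ (n - k)

end CanonicalMoments

end

/-! Substituting x = (a+b)/2 + ((b-a)/2) cos θ turns a measure on [a,b] into a conjugation-symmetric
measure on the unit circle. Such a measure has real Verblunsky coefficients α_j, and the canonical
moment of order j+1 is (1 + α_j)/2. So `momentMap` sends p to α = 2p - 1, then by the Szegő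
recursion to trigonometric moments (`trigMoment`), then to ordinary moments (`cosStep`). Both
passages are triangular: with p_1, ..., p_{k-1} fixed, m_k is affine in p_k, with slope (b-a)^k
∏_{j<k} p_j(1-p_j), the `width` (`momentMap_sub`).

This slope equals m_k^+ - m_k^-. No measure leaves the corresponding interval, because a Szegő
polynomial and its reversal have equal modulus on the circle (`abs_moment_sub_le`). The whole
interval is attained, because all coefficients in [-1,1] come from the spectral measure of a finite
orthogonal matrix (`exists_moment_eq`). Hence `canonicalMoment` inverts `momentMap` on the open unit
cube, whose image is the set where all the strict inequalities hold.

The Jacobian is triangular with determinant ∏ (b-a)^k (p_k - p_k²)^{n-k}, again a product over k.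
The change of variables therefore shows the law to be the image of a product measure
(`momentLaw_eq_map`), which gives normalization, independence and marginals at once. The
nonvanishing Jacobian puts the image in the interior. -/

namespace CanonicalMoments

/-! ### Triangular recursions from Verblunsky coefficients to moments -/

/-- The companion row of a row `d`, obtained by the reversed Szegő recursion. -/
def starRow (α d : ℕ → ℝ) : ℕ → ℝ
  | 0 => d 0
  | j + 1 => (1 - α j ^ 2) * starRow α d j - α j * d (j + 1)

/-- `row α k j` is the value at `X ^ k * φ_j` of the functional which has the Verblunsky
coefficients `α`, where `φ_j` is the monic Szegő polynomial of degree `j`. -/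
def row (α : ℕ → ℝ) : ℕ → ℕ → ℝ
  | 0 => fun j => if j = 0 then 1 else 0
  | k + 1 => fun j => row α k (j + 1) + α j * starRow α (row α k) j

/-- The trigonometric moments that belong to the Verblunsky coefficients `α`. -/
def trigMoment (α : ℕ → ℝ) (k : ℕ) : ℝ := row α k 0

/-- The squared norm of the monic Szegő polynomial of degree `j`. -/
def normSq (α : ℕ → ℝ) (j : ℕ) : ℝ := ∏ i ∈ Finset.range j, (1 - α i ^ 2)

/-- The effect on the sequence `∫ cos (j θ)` of multiplying the integrand by `h + r cos θ`. -/
noncomputable def cosStep (h r : ℝ) (c : ℕ → ℝ) : ℕ → ℝ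
  | 0 => h * c 0 + r * c 1
  | j + 1 => h * c (j + 1) + r / 2 * (c (j + 2) + c j)

theorem starRow_congr {α α' d d' : ℕ → ℝ} {J : ℕ} (hα : ∀ i < J, α i = α' i)
    (hd : ∀ j ≤ J, d j = d' j) : ∀ j ≤ J, starRow α d j = starRow α' d' j
  | 0, _ => hd 0 (Nat.zero_le _)
  | j + 1, hj => by
    simp only [starRow]
    rw [hα j hj, hd (j + 1) hj, starRow_congr hα hd j (by omega)]

theorem row_congr {α α' : ℕ → ℝ} {K : ℕ} (hα : ∀ i < K, α i = α' i) :
    ∀ k j, k + j ≤ K → row α k j = row α' k j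
  | 0, _, _ => rfl
  | k + 1, j, h => by
    simp only [row]
    rw [row_congr hα k (j + 1) (by omega), hα j (by omega),
      starRow_congr (J := j) (fun i hi => hα i (by omega))
        (fun i hi => row_congr hα k i (by omega)) j le_rfl]

theorem trigMoment_congr {α α' : ℕ → ℝ} {K : ℕ} (hα : ∀ i < K, α i = α' i) {k : ℕ}
    (hk : k ≤ K) : trigMoment α k = trigMoment α' k :=
  row_congr hα k 0 (by omega)

theorem normSq_congr {α α' : ℕ → ℝ} {K : ℕ} (hα : ∀ i < K, α i = α' i) :
    normSq α K = normSq α' K :=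
  Finset.prod_congr rfl fun i hi => by rw [hα i (Finset.mem_range.1 hi)]

theorem row_succ (α : ℕ → ℝ) (k j : ℕ) :
    row α (k + 1) j = row α k (j + 1) + α j * starRow α (row α k) j := rfl

theorem normSq_succ (α : ℕ → ℝ) (j : ℕ) : normSq α (j + 1) = normSq α j * (1 - α j ^ 2) :=
  Finset.prod_range_succ _ _

/-- The functional kills every φ_{j+1}, so the reversed recursion reduces to multiplication by 1 -
α_j². -/
theorem starRow_row_zero (α : ℕ → ℝ) : ∀ j, starRow α (row α 0) j = normSq α j
  | 0 => by simp [starRow, row, normSq]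
  | j + 1 => by
    rw [starRow, starRow_row_zero α j, normSq_succ]
    simp [row, mul_comm]

/-- Along an antidiagonal the star terms involve only coefficients before α_K. The difference is
thus carried unchanged down to k = 0, where α_K multiplies `starRow α (row α 0) K`, which is `normSq
α K`. -/
theorem row_sub {α α' : ℕ → ℝ} {K : ℕ} (hα : ∀ i < K, α i = α' i) :
    ∀ k j, k + j = K → row α (k + 1) j - row α' (k + 1) j = (α K - α' K) * normSq α K
  | 0, j, h => by
    obtain rfl : j = K := by omega
    rw [row_succ, row_succ, starRow_row_zero, starRow_row_zero, ← normSq_congr hα]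
    simp [row, sub_mul]
  | k + 1, j, h => by
    have h1 := row_sub hα k (j + 1) (by omega)
    have h2 := starRow_congr (J := j) (d := row α (k + 1)) (d' := row α' (k + 1))
      (fun i hi => hα i (by omega)) (fun i hi => row_congr hα (k + 1) i (by omega)) j le_rfl
    rw [row_succ, row_succ α' (k + 1), h2, hα j (by omega)]
    linarith

theorem trigMoment_succ_sub {α α' : ℕ → ℝ} {K : ℕ} (hα : ∀ i < K, α i = α' i) :
    trigMoment α (K + 1) - trigMoment α' (K + 1) = (α K - α' K) * normSq α K :=
  row_sub hα K 0 rfl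

/-- After k steps, entry j depends on c only up to index k + j, and each step gives the top entry a
factor r/2. The extra 2 at j = 0 arises because c_{-1} = c_1 doubles the neighbour there. -/
theorem iterate_cosStep_sub (h r : ℝ) {c c' : ℕ → ℝ} {K : ℕ} (hc : ∀ j < K, c j = c' j) :
    ∀ k j, (k + j < K → (cosStep h r)^[k] c j = (cosStep h r)^[k] c' j) ∧
      (k + j = K → 1 ≤ j →
        (cosStep h r)^[k] c j - (cosStep h r)^[k] c' j = (r / 2) ^ k * (c K - c' K)) ∧
      (k = K → 1 ≤ k → j = 0 →
        (cosStep h r)^[k] c j - (cosStep h r)^[k] c' j = 2 * (r / 2) ^ k * (c K - c' K))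
  | 0, j => by
    refine ⟨fun hj => hc j (by omega), fun hj _ => ?_, fun _ h0 => by omega⟩
    obtain rfl : j = K := by omega
    simp
  | k + 1, j => by
    have ih := iterate_cosStep_sub h r hc k
    simp only [Function.iterate_succ_apply']
    refine ⟨fun hj => ?_, fun hj h1 => ?_, fun hk _ hj => ?_⟩
    · cases j with
      | zero => simp only [cosStep]; rw [(ih 0).1 (by omega), (ih 1).1 (by omega)]
      | succ j =>
        simp only [cosStep]
        rw [(ih j).1 (by omega), (ih (j + 1)).1 (by omega), (ih (j + 2)).1 (by omega)]
    · cases j with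
      | zero => omega
      | succ j =>
        simp only [cosStep]
        rw [(ih j).1 (by omega), (ih (j + 1)).1 (by omega), pow_succ]
        linear_combination (r / 2) * (ih (j + 2)).2.1 (by omega) (by omega)
    · subst hj
      simp only [cosStep]
      rw [(ih 0).1 (by omega), pow_succ]
      linear_combination r * (ih 1).2.1 (by omega) le_rfl

theorem iterate_cosStep_congr (h r : ℝ) {c c' : ℕ → ℝ} {K : ℕ} (hc : ∀ j ≤ K, c j = c' j) :
    (cosStep h r)^[K] c 0 = (cosStep h r)^[K] c' 0 :=
  (iterate_cosStep_sub h r (K := K + 1) (fun j hj => hc j (by omega)) K 0).1 (by omega)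

theorem iterate_cosStep_succ_sub (h r : ℝ) {c c' : ℕ → ℝ} {K : ℕ} (hc : ∀ j ≤ K, c j = c' j) :
    (cosStep h r)^[K + 1] c 0 - (cosStep h r)^[K + 1] c' 0 =
      2 * (r / 2) ^ (K + 1) * (c (K + 1) - c' (K + 1)) :=
  (iterate_cosStep_sub h r (K := K + 1) (fun j hj => hc j (by omega)) (K + 1) 0).2.2 rfl
    (by omega) rfl

/-- The trigonometric moments are determined by the ordinary ones. -/
theorem eq_of_iterate_cosStep_eq (h : ℝ) {r : ℝ} (hr : 0 < r) {c c' : ℕ → ℝ} {K : ℕ}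
    (H : ∀ k ≤ K, (cosStep h r)^[k] c 0 = (cosStep h r)^[k] c' 0) : ∀ k ≤ K, c k = c' k := by
  intro k
  induction k using Nat.strong_induction_on with
  | _ k ih =>
    intro hk
    cases k with
    | zero => simpa using H 0 hk
    | succ k =>
      have h1 := iterate_cosStep_succ_sub h r (c := c) (c' := c') (K := k)
        (fun j hj => ih j (by omega) (by omega))
      rw [H _ hk, sub_self] at h1
      have h2 : (2 * (r / 2) ^ (k + 1) : ℝ) ≠ 0 := by positivity
      have := (mul_eq_zero.1 h1.symm).resolve_left h2
      linarith

open scoped InnerProductSpace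

/-! ### Moments of a symmetric operator as moments of a measure -/

section Spectral

variable {E : Type*} [NormedAddCommGroup E] [InnerProductSpace ℝ E]

/-- The spectral measure of a symmetric operator at a unit vector. -/
theorem exists_momentMeasures_of_isSymmetric [FiniteDimensional ℝ E] {T : E →ₗ[ℝ] E}
    (hT : T.IsSymmetric) {a b : ℝ} (ha : ∀ x, a * ‖x‖ ^ 2 ≤ ⟪T x, x⟫_ℝ)
    (hb : ∀ x, ⟪T x, x⟫_ℝ ≤ b * ‖x‖ ^ 2) {e : E} (he : ‖e‖ = 1) :
    ∃ μ ∈ momentMeasures (Set.Icc a b), ∀ k, moment μ k = ⟪(T ^ k) e, e⟫_ℝ := by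
  classical
  set u := hT.eigenvectorBasis rfl with hu
  set l := hT.eigenvalues rfl with hl
  have hTu : ∀ i, T (u i) = l i • u i := fun i => hT.apply_eigenvectorBasis rfl i
  have hl_mem : ∀ i, l i ∈ Set.Icc a b := by
    intro i
    have h1 := ha (u i)
    have h2 := hb (u i)
    rw [hTu, inner_smul_left, real_inner_self_eq_norm_sq, u.norm_eq_one] at h1 h2
    simp only [conj_trivial, one_pow, mul_one] at h1 h2
    exact ⟨h1, h2⟩
  have hpow : ∀ k i, ⟪(T ^ k) e, u i⟫_ℝ = l i ^ k * ⟪e, u i⟫_ℝ := by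
    intro k i
    induction k with
    | zero => simp
    | succ k ih =>
      rw [pow_succ', Module.End.mul_apply, hT, hTu, inner_smul_right, ih]
      ring
  -- Atoms at the eigenvalues, weighted by the squared coordinates of e in the eigenbasis.
  set μ : Measure ℝ := ∑ i, ENNReal.ofReal (⟪e, u i⟫_ℝ ^ 2) • Measure.dirac (l i) with hμ
  have hint : ∀ (g : ℝ → ℝ) i,
      Integrable g (ENNReal.ofReal (⟪e, u i⟫_ℝ ^ 2) • Measure.dirac (l i)) := fun g i =>
    (integrable_dirac (by simp)).smul_measure ENNReal.ofReal_ne_top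
  have hsum : ∑ i, ⟪e, u i⟫_ℝ ^ 2 = 1 := by
    have := u.sum_sq_norm_inner_left e
    simpa [he] using this
  refine ⟨μ, ⟨⟨?_⟩, ?_, fun k => ?_⟩, fun k => ?_⟩
  · rw [hμ, Measure.finsetSum_apply]
    simp only [Measure.smul_apply, measure_univ, smul_eq_mul, mul_one]
    rw [← ENNReal.ofReal_sum_of_nonneg (fun _ _ => sq_nonneg _), hsum, ENNReal.ofReal_one]
  · rw [hμ, Measure.finsetSum_apply]
    refine Finset.sum_eq_zero fun i _ => ?_
    rw [Measure.smul_apply, Measure.dirac_apply' _ measurableSet_Icc.compl]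
    simp [hl_mem i]
  · rw [hμ, integrable_finsetSum_measure]
    exact fun i _ => hint _ i
  · rw [moment, hμ, integral_finsetSum_measure fun i _ => hint _ i,
      ← u.sum_inner_mul_inner ((T ^ k) e) e]
    refine Finset.sum_congr rfl fun i _ => ?_
    rw [integral_smul_measure, integral_dirac, ENNReal.toReal_ofReal (sq_nonneg _), hpow,
      real_inner_comm e (u i), smul_eq_mul]
    ring

end Spectral

/-! ### A finite orthogonal matrix with prescribed Verblunsky coefficients -/

section Model

variable {E : Type*} [NormedAddCommGroup E] [InnerProductSpace ℝ E]

/-- The vectors that represent the normalized reversed Szegő polynomials, when `e` represents the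
normalized Szegő polynomials. -/
noncomputable def starVec (α : ℕ → ℝ) (e : ℕ → E) : ℕ → E
  | 0 => e 0
  | j + 1 => √(1 - α j ^ 2) • starVec α e j - α j • e (j + 1)

/-- The images of the vectors `e j` under multiplication by the variable. -/
noncomputable def shiftVec (α : ℕ → ℝ) (e : ℕ → E) (j : ℕ) : E :=
  √(1 - α j ^ 2) • e (j + 1) + α j • starVec α e j

variable {α : ℕ → ℝ} {e : ℕ → E}

theorem inner_starVec_of_lt (he : ∀ i j, i ≠ j → ⟪e i, e j⟫_ℝ = 0) :
    ∀ {j i : ℕ}, j < i → ⟪starVec α e j, e i⟫_ℝ = 0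
  | 0, i, h => he 0 i (by omega)
  | j + 1, i, h => by
    rw [starVec, inner_sub_left, inner_smul_left, inner_smul_left, he _ _ (by omega),
      inner_starVec_of_lt he (by omega)]
    simp

theorem inner_shiftVec_of_lt (he : ∀ i j, i ≠ j → ⟪e i, e j⟫_ℝ = 0) {j i : ℕ} (h : j + 1 < i) :
    ⟪shiftVec α e j, e i⟫_ℝ = 0 := by
  rw [shiftVec, inner_add_left, inner_smul_left, inner_smul_left, he _ _ (by omega),
    inner_starVec_of_lt he (by omega)]
  simp

theorem inner_starVec_self (hα : ∀ i, α i ^ 2 ≤ 1) (he : ∀ i j, i ≠ j → ⟪e i, e j⟫_ℝ = 0) {n : ℕ}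
    (he1 : ∀ i ≤ n, ⟪e i, e i⟫_ℝ = 1) : ∀ j ≤ n, ⟪starVec α e j, starVec α e j⟫_ℝ = 1
  | 0, h => he1 0 h
  | j + 1, h => by
    have h1 := inner_starVec_self hα he he1 j (by omega)
    have h2 := inner_starVec_of_lt (α := α) he (Nat.lt_succ_self j)
    have h3 := Real.sq_sqrt (sub_nonneg.2 (hα j))
    simp only [starVec, inner_sub_left, inner_sub_right, inner_smul_left, inner_smul_right,
      real_inner_comm (starVec α e j) (e (j + 1)), h1, h2, he1 (j + 1) h, conj_trivial]
    linear_combination h3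

theorem inner_starVec_shiftVec (hα : ∀ i, α i ^ 2 ≤ 1) (he : ∀ i j, i ≠ j → ⟪e i, e j⟫_ℝ = 0)
    {n : ℕ} (he1 : ∀ i ≤ n, ⟪e i, e i⟫_ℝ = 1) {j : ℕ} :
    ∀ k, j < k → k ≤ n → ⟪starVec α e k, shiftVec α e j⟫_ℝ = 0
  | 0, h, _ => by omega
  | k + 1, h, hn => by
    rcases Nat.lt_succ_iff_lt_or_eq.1 h with h | rfl
    · rw [starVec, inner_sub_left, inner_smul_left, inner_smul_left,
        inner_starVec_shiftVec hα he he1 k h (by omega), real_inner_comm,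
        inner_shiftVec_of_lt he (by omega)]
      simp
    · have h1 := inner_starVec_self hα he he1 j (by omega)
      have h2 := inner_starVec_of_lt (α := α) he (Nat.lt_succ_self j)
      simp only [starVec, shiftVec, inner_sub_left, inner_add_right, inner_smul_left,
        inner_smul_right, real_inner_comm (starVec α e j) (e (j + 1)), h1, h2, he1 (j + 1) hn,
        conj_trivial]
      ring

theorem inner_shiftVec_shiftVec (hα : ∀ i, α i ^ 2 ≤ 1) (he : ∀ i j, i ≠ j → ⟪e i, e j⟫_ℝ = 0)
    {n : ℕ} (he1 : ∀ i ≤ n, ⟪e i, e i⟫_ℝ = 1) {j k : ℕ} (hjk : j < k) (hk : k ≤ n) :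
    ⟪shiftVec α e k, shiftVec α e j⟫_ℝ = 0 := by
  rw [shiftVec, inner_add_left, inner_smul_left, inner_smul_left, real_inner_comm,
    inner_shiftVec_of_lt he (by omega), inner_starVec_shiftVec hα he he1 k hjk hk]
  simp

theorem inner_shiftVec_self (hα : ∀ i, α i ^ 2 ≤ 1) (he : ∀ i j, i ≠ j → ⟪e i, e j⟫_ℝ = 0)
    {n : ℕ} (hn : α n = 1) (he1 : ∀ i ≤ n, ⟪e i, e i⟫_ℝ = 1) {j : ℕ} (hj : j ≤ n) :
    ⟪shiftVec α e j, shiftVec α e j⟫_ℝ = 1 := by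
  have h1 := inner_starVec_self hα he he1 j hj
  have h2 := inner_starVec_of_lt (α := α) he (Nat.lt_succ_self j)
  have h3 := Real.sq_sqrt (sub_nonneg.2 (hα j))
  simp only [shiftVec, inner_add_left, inner_add_right, inner_smul_left, inner_smul_right,
    real_inner_comm (starVec α e j) (e (j + 1)), h1, h2, conj_trivial]
  rcases hj.lt_or_eq with h | rfl
  · rw [he1 (j + 1) h]
    linear_combination h3
  · simp [hn]

/-- The product of square roots is the norm of the monic Szegő polynomial: `row` refers to monic
polynomials, the vectors `e j` to normalized ones. -/
theorem row_eq_inner (hα : ∀ i, α i ^ 2 ≤ 1) (he : ∀ i j, i ≠ j → ⟪e i, e j⟫_ℝ = 0)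
    (he0 : ⟪e 0, e 0⟫_ℝ = 1) {A : E →ₗ[ℝ] E} (hA : ∀ j, A (e j) = shiftVec α e j) (k : ℕ) :
    ∀ j, row α k j = (∏ i ∈ Finset.range j, √(1 - α i ^ 2)) * ⟪(A ^ k) (e j), e 0⟫_ℝ ∧
      starRow α (row α k) j =
        (∏ i ∈ Finset.range j, √(1 - α i ^ 2)) * ⟪(A ^ k) (starVec α e j), e 0⟫_ℝ := by
  have key : ∀ k,
      (∀ j, row α k j = (∏ i ∈ Finset.range j, √(1 - α i ^ 2)) * ⟪(A ^ k) (e j), e 0⟫_ℝ) →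
      ∀ j, starRow α (row α k) j =
        (∏ i ∈ Finset.range j, √(1 - α i ^ 2)) * ⟪(A ^ k) (starVec α e j), e 0⟫_ℝ := by
    intro k hk j
    induction j with
    | zero => exact hk 0
    | succ j ih =>
      rw [starRow, starVec, ih, hk, map_sub, map_smul, map_smul, inner_sub_left, inner_smul_left,
        inner_smul_left, Finset.prod_range_succ]
      simp only [conj_trivial]
      have h3 := Real.sq_sqrt (sub_nonneg.2 (hα j))
      linear_combination
        -(∏ i ∈ Finset.range j, √(1 - α i ^ 2)) * ⟪(A ^ k) (starVec α e j), e 0⟫_ℝ * h3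
  have main : ∀ k j,
      row α k j = (∏ i ∈ Finset.range j, √(1 - α i ^ 2)) * ⟪(A ^ k) (e j), e 0⟫_ℝ := by
    intro k
    induction k with
    | zero =>
      intro j
      rcases eq_or_ne j 0 with rfl | hj
      · simp only [row, if_true, Finset.range_zero, Finset.prod_empty, pow_zero,
          Module.End.one_apply, he0, mul_one]
      · simp [row, hj, he j 0 hj]
    | succ k ih =>
      intro j
      rw [row_succ, ih, key k ih, pow_succ, Module.End.mul_apply, hA, shiftVec, map_add, map_smul,
        map_smul, inner_add_left, inner_smul_left, inner_smul_left, Finset.prod_range_succ]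
      simp only [conj_trivial]
      ring
  exact fun j => ⟨main k j, key k (main k) j⟩

/-- With B = A⁻¹ as adjoint, h + (r/2)(A + B) is the operator form of h + r cos θ and commutes with
A. -/
theorem iterate_cosStep_eq_inner {A B : E →ₗ[ℝ] E} (hAB : ∀ x y, ⟪A x, y⟫_ℝ = ⟪x, B y⟫_ℝ)
    (hBA : ∀ x, B (A x) = x) (hAB' : ∀ x, A (B x) = x) {c : ℕ → ℝ} {v : E}
    (hc : ∀ j, c j = ⟪(A ^ j) v, v⟫_ℝ) (h r : ℝ) (k : ℕ) :
    ∀ j, (cosStep h r)^[k] c j =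
      ⟪((h • LinearMap.id + (r / 2) • (A + B) : E →ₗ[ℝ] E) ^ k) ((A ^ j) v), v⟫_ℝ := by
  set T : E →ₗ[ℝ] E := h • LinearMap.id + (r / 2) • (A + B) with hT
  have hTx : ∀ x, T x = h • x + (r / 2) • (A x + B x) := fun x => by simp [hT]
  have hB : ∀ x y, ⟪B x, y⟫_ℝ = ⟪x, A y⟫_ℝ := fun x y => by
    rw [real_inner_comm, ← hAB, real_inner_comm]
  have hTs : ∀ k x y, ⟪(T ^ k) x, y⟫_ℝ = ⟪x, (T ^ k) y⟫_ℝ := by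
    intro k
    induction k with
    | zero => simp
    | succ k ih =>
      intro x y
      rw [pow_succ, Module.End.mul_apply, ih, ← pow_succ, pow_succ', Module.End.mul_apply, hTx,
        hTx]
      simp only [inner_add_left, inner_add_right, inner_smul_left, inner_smul_right, hAB,
        conj_trivial]
      rw [hB]
      ring
  have hTA : Commute A T := by
    ext x
    simp [hTx, hBA, hAB']
  induction k with
  | zero => exact fun j => by simpa using hc j
  | succ k ih =>
    intro j
    rw [Function.iterate_succ_apply', pow_succ, Module.End.mul_apply, hTx]
    simp only [map_add, map_smul, inner_add_left, inner_smul_left, conj_trivial]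
    have hA1 : ∀ j, A ((A ^ j) v) = (A ^ (j + 1)) v := fun j => by
      rw [pow_succ', Module.End.mul_apply]
    cases j with
    | zero =>
      -- The symmetry c_{-1} = c_1: B is the adjoint of A, and the scalars are real.
      have h1 : ⟪(T ^ k) (B v), v⟫_ℝ = ⟪(T ^ k) (A v), v⟫_ℝ := by
        rw [hTs, real_inner_comm, ← hAB, ← Module.End.mul_apply, ← Module.End.mul_apply,
          (hTA.pow_right k).eq]
      rw [cosStep, ih, ih]
      simp only [pow_zero, pow_one, Module.End.one_apply, h1]
      ring
    | succ j =>
      rw [cosStep, ih, ih, ih, hA1, ← hA1 j, hBA]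

/-- Every sequence of Verblunsky coefficients in `[-1, 1]` with `α n = 1` belongs to a measure. -/
theorem exists_moment_eq {α : ℕ → ℝ} (hα : ∀ i, α i ^ 2 ≤ 1) {n : ℕ} (hn : ∀ i, n ≤ i → α i = 1)
    {a b : ℝ} (hab : a ≤ b) :
    ∃ μ ∈ momentMeasures (Set.Icc a b), ∀ k,
      moment μ k = (cosStep ((a + b) / 2) ((b - a) / 2))^[k] (trigMoment α) 0 := by
  classical
  let E := EuclideanSpace ℝ (Fin (n + 1))
  let v : OrthonormalBasis (Fin (n + 1)) ℝ E := EuclideanSpace.basisFun _ ℝ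
  -- The vectors vanish past index n. Since α n = 1, the last shifted vector is `starVec α e n`,
  -- still of norm 1, so the shifted vectors form an orthonormal basis.
  let e : ℕ → E := fun j => if h : j < n + 1 then v ⟨j, h⟩ else 0
  have hev : ∀ i : Fin (n + 1), e i = v i := fun i => dif_pos i.isLt
  have hev0 : ∀ j, ¬ j < n + 1 → e j = 0 := fun j hj => dif_neg hj
  have he : ∀ i j, i ≠ j → ⟪e i, e j⟫_ℝ = 0 := by
    intro i j hij
    by_cases hi : i < n + 1
    · by_cases hj : j < n + 1
      · simp only [e, hi, hj, dif_pos]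
        exact v.inner_eq_zero (by simpa using hij)
      · rw [hev0 j hj, inner_zero_right]
    · rw [hev0 i hi, inner_zero_left]
  have he1 : ∀ i ≤ n, ⟪e i, e i⟫_ℝ = 1 := by
    intro i hi
    simp only [e, Nat.lt_succ_of_le hi, dif_pos]
    exact v.inner_eq_one _
  let w : Fin (n + 1) → E := fun i => shiftVec α e i
  have hw : Orthonormal ℝ w := by
    rw [orthonormal_iff_ite]
    intro i j
    split_ifs with hij
    · subst hij
      exact inner_shiftVec_self hα he (hn n le_rfl) he1 (by omega)
    · rcases lt_or_gt_of_ne (fun h => hij (Fin.ext h) : (i : ℕ) ≠ j) with h | h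
      · rw [real_inner_comm]
        exact inner_shiftVec_shiftVec hα he he1 h (by omega)
      · exact inner_shiftVec_shiftVec hα he he1 h (by omega)
  let w' : OrthonormalBasis (Fin (n + 1)) ℝ E := OrthonormalBasis.mk hw (by
    rw [hw.linearIndependent.span_eq_top_of_card_eq_finrank (by simp [E])])
  let U : E ≃ₗᵢ[ℝ] E := v.equiv w' (Equiv.refl _)
  have hUv : ∀ i, U (v i) = w i := fun i => by simp [U, w']
  have hs : ∀ j, n < j → starVec α e j = 0 := by
    intro j hj
    obtain ⟨j, rfl⟩ : ∃ i, j = i + 1 := ⟨j - 1, by omega⟩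
    simp [starVec, hn j (by omega), hev0 (j + 1) (by omega)]
  have hU : ∀ j, U (e j) = shiftVec α e j := by
    intro j
    by_cases hj : j < n + 1
    · have := hUv ⟨j, hj⟩
      rwa [← hev] at this
    · rw [shiftVec, hs j (by omega), hev0 j hj, hev0 (j + 1) (by omega)]
      simp
  let A : E →ₗ[ℝ] E := U.toLinearEquiv.toLinearMap
  let B : E →ₗ[ℝ] E := U.symm.toLinearEquiv.toLinearMap
  have hAB : ∀ x y, ⟪A x, y⟫_ℝ = ⟪x, B y⟫_ℝ := fun x y => by
    have := U.inner_map_map x (U.symm y)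
    rwa [U.apply_symm_apply] at this
  have hAx : ∀ x, ‖A x‖ = ‖x‖ := fun x => U.norm_map x
  have hc : ∀ j, trigMoment α j = ⟪(A ^ j) (e 0), e 0⟫_ℝ := fun j => by
    have := (row_eq_inner hα he (he1 0 (by omega)) (A := A) hU j 0).1
    rwa [Finset.range_zero, Finset.prod_empty, one_mul] at this
  have hm := fun k => iterate_cosStep_eq_inner hAB (fun x => U.symm_apply_apply x)
    (fun x => U.apply_symm_apply x) hc ((a + b) / 2) ((b - a) / 2) k 0
  set T : E →ₗ[ℝ] E := ((a + b) / 2) • LinearMap.id + ((b - a) / 2 / 2) • (A + B) with hT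
  have hTx : ∀ x, ⟪T x, x⟫_ℝ = (a + b) / 2 * ‖x‖ ^ 2 + (b - a) / 2 * ⟪A x, x⟫_ℝ := by
    intro x
    have : ⟪B x, x⟫_ℝ = ⟪A x, x⟫_ℝ := by rw [hAB, real_inner_comm]
    simp only [hT, LinearMap.add_apply, LinearMap.smul_apply, LinearMap.id_apply, inner_add_left,
      inner_smul_left, conj_trivial, real_inner_self_eq_norm_sq, this]
    ring
  -- A is an isometry, so the quadratic form of T lies between the multiples (a+b)/2 ∓ (b-a)/2 of
  -- ‖x‖², that is, a and b.
  have hAle : ∀ x, |⟪A x, x⟫_ℝ| ≤ ‖x‖ ^ 2 := fun x => by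
    have := abs_real_inner_le_norm (A x) x
    rwa [hAx, ← sq] at this
  have hTsymm : T.IsSymmetric := by
    intro x y
    simp only [hT, LinearMap.add_apply, LinearMap.smul_apply, LinearMap.id_apply, inner_add_left,
      inner_add_right, inner_smul_left, inner_smul_right, conj_trivial, hAB]
    have hB : ⟪B x, y⟫_ℝ = ⟪x, A y⟫_ℝ := by rw [real_inner_comm, ← hAB, real_inner_comm]
    rw [hB]
    ring
  obtain ⟨μ, hμ, hμm⟩ := exists_momentMeasures_of_isSymmetric hTsymm (a := a) (b := b) (e := e 0)
    (fun x => by rw [hTx]; nlinarith [(abs_le.1 (hAle x)).1])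
    (fun x => by rw [hTx]; nlinarith [(abs_le.1 (hAle x)).2])
    (by rw [← sq_eq_sq₀ (norm_nonneg _) zero_le_one, ← real_inner_self_eq_norm_sq,
      he1 0 (by omega), one_pow])
  exact ⟨μ, hμ, fun k => by rw [hμm, hm]; simp⟩

end Model

/-! ### Szegő polynomials and the range of the next trigonometric moment -/

open scoped ComplexConjugate

/-- The monic Szegő polynomial of degree `j` and its reversal. -/
noncomputable def szego (α : ℕ → ℝ) : ℕ → ℂ → ℂ × ℂ
  | 0 => fun _ => (1, 1)
  | j + 1 => fun w => (w * (szego α j w).1 - α j * (szego α j w).2,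
      (szego α j w).2 - α j * (w * (szego α j w).1))

theorem continuous_szego (α : ℕ → ℝ) : ∀ j, Continuous (szego α j)
  | 0 => continuous_const
  | j + 1 => by
    have := continuous_szego α j
    simp only [szego]
    fun_prop

@[fun_prop]
theorem continuous_szego_fst (α : ℕ → ℝ) (j : ℕ) : Continuous fun w => (szego α j w).1 :=
  (continuous_szego α j).fst

@[fun_prop]
theorem continuous_szego_snd (α : ℕ → ℝ) (j : ℕ) : Continuous fun w => (szego α j w).2 :=
  (continuous_szego α j).snd

theorem mul_conj_of_norm_eq_one {w : ℂ} (hw : ‖w‖ = 1) : w * conj w = 1 := by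
  rw [Complex.mul_conj, Complex.normSq_eq_norm_sq, hw]
  simp

/-- On the circle conj w = w⁻¹, so conjugation followed by multiplication by w^j reverses the real
coefficients. -/
theorem szego_snd (α : ℕ → ℝ) {w : ℂ} (hw : ‖w‖ = 1) :
    ∀ j, (szego α j w).2 = w ^ j * conj (szego α j w).1
  | 0 => by simp [szego]
  | j + 1 => by
    have h1 := mul_conj_of_norm_eq_one hw
    have h2 : w ^ j * (conj w) ^ j = 1 := by rw [← mul_pow, h1, one_pow]
    simp only [szego, szego_snd α hw j, map_sub, map_mul, map_pow, Complex.conj_ofReal,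
      Complex.conj_conj]
    linear_combination (-(w ^ j * conj (szego α j w).1)) * h1 + α j * w * (szego α j w).1 * h2

theorem norm_szego_snd (α : ℕ → ℝ) {w : ℂ} (hw : ‖w‖ = 1) (j : ℕ) :
    ‖(szego α j w).2‖ = ‖(szego α j w).1‖ := by
  rw [szego_snd α hw]
  simp [hw]

section Circle

variable {Ω : Type*} [MeasurableSpace Ω]

/-- The integral of the real part of a function on the unit circle. -/
noncomputable def circleInt (μ : Measure Ω) (z : Ω → ℂ) (f : ℂ → ℂ) : ℝ := ∫ ω, (f (z ω)).re ∂μ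

variable {μ : Measure Ω} [IsFiniteMeasure μ] {z : Ω → ℂ}

theorem integrable_re_comp (hz : Measurable z) (hz1 : ∀ ω, ‖z ω‖ = 1) {f : ℂ → ℂ}
    (hf : Continuous f) : Integrable (fun ω => (f (z ω)).re) μ := by
  obtain ⟨C, hC⟩ := (isCompact_sphere (0 : ℂ) 1).exists_bound_of_continuousOn hf.continuousOn
  refine Integrable.of_bound (C := C) (by fun_prop) (Filter.Eventually.of_forall fun ω => ?_)
  rw [Real.norm_eq_abs]
  exact (Complex.abs_re_le_norm _).trans (hC _ (by simp [hz1]))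

omit [IsFiniteMeasure μ] in
theorem circleInt_congr (hz1 : ∀ ω, ‖z ω‖ = 1) {f g : ℂ → ℂ}
    (h : ∀ w, ‖w‖ = 1 → (f w).re = (g w).re) : circleInt μ z f = circleInt μ z g :=
  integral_congr_ae (Filter.Eventually.of_forall fun ω => h _ (hz1 ω))

/-- Real parts symmetrize the measure under conjugation, so linearity is used over real scalars
only. -/
theorem circleInt_sub (hz : Measurable z) (hz1 : ∀ ω, ‖z ω‖ = 1) {f g k : ℂ → ℂ}
    (hf : Continuous f) (hg : Continuous g) (c : ℝ)
    (h : ∀ w, ‖w‖ = 1 → k w = f w - c * g w) :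
    circleInt μ z k = circleInt μ z f - c * circleInt μ z g := by
  rw [circleInt_congr hz1 (g := fun w => f w - c * g w) fun w hw => by rw [h w hw]]
  simp only [circleInt, Complex.sub_re, Complex.re_ofReal_mul]
  rw [integral_sub (integrable_re_comp hz hz1 hf)
    ((integrable_re_comp hz hz1 hg).const_mul c), integral_const_mul]

variable (hz : Measurable z) (hz1 : ∀ ω, ‖z ω‖ = 1) {α : ℕ → ℝ} {K : ℕ}
  (hc : ∀ i ≤ K, circleInt μ z (fun w => w ^ i) = trigMoment α i)

include hz hz1 hc

theorem circleInt_pow_mul_szego (j : ℕ) : ∀ i, i + j ≤ K →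
    circleInt μ z (fun w => w ^ i * (szego α j w).1) = row α i j ∧
      circleInt μ z (fun w => w ^ i * (szego α j w).2) = starRow α (row α i) j := by
  induction j with
  | zero =>
    intro i hi
    simp only [szego, mul_one]
    exact ⟨hc i hi, hc i hi⟩
  | succ j ih =>
    intro i hi
    have h1 := (ih (i + 1) (by omega)).1
    have h2 := (ih i (by omega)).2
    constructor
    · rw [circleInt_sub hz hz1 (f := fun w => w ^ (i + 1) * (szego α j w).1)
        (g := fun w => w ^ i * (szego α j w).2) (by fun_prop) (by fun_prop) (α j)
        (fun w _ => by simp only [szego]; ring), h1, h2, row_succ]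
      ring
    · rw [circleInt_sub hz hz1 (f := fun w => w ^ i * (szego α j w).2)
        (g := fun w => w ^ (i + 1) * (szego α j w).1) (by fun_prop) (by fun_prop) (α j)
        (fun w _ => by simp only [szego]; ring), h1, h2, row_succ, starRow]
      ring

/-- The (K+1)-st moment is not prescribed. It enters with coefficient 1 because the polynomials are
monic of total degree K + 1 here. -/
theorem circleInt_pow_mul_szego_sub (j : ℕ) : ∀ i, i + j = K + 1 →
    circleInt μ z (fun w => w ^ i * (szego α j w).1) - row α i j =
      circleInt μ z (fun w => w ^ (K + 1)) - trigMoment α (K + 1) := by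
  induction j with
  | zero =>
    rintro i rfl
    simp [szego, trigMoment]
  | succ j ih =>
    intro i hi
    have h2 := (circleInt_pow_mul_szego hz hz1 hc j i (by omega)).2
    rw [← ih (i + 1) (by omega),
      circleInt_sub hz hz1 (f := fun w => w ^ (i + 1) * (szego α j w).1)
        (g := fun w => w ^ i * (szego α j w).2) (by fun_prop) (by fun_prop) (α j)
        (fun w _ => by simp only [szego]; ring), h2, row_succ]
    ring

theorem circleInt_szego_mul_conj_pow : ∀ j ≤ K, ∀ i < j,
    circleInt μ z (fun w => (szego α j w).1 * conj (w ^ i)) = 0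
  | 0, _, i, h => by omega
  | j + 1, hj, 0, _ => by
    have := (circleInt_pow_mul_szego hz hz1 hc (j + 1) 0 (by omega)).1
    simpa [row] using this
  | j + 1, hj, i + 1, hi => by
    have h1 := circleInt_szego_mul_conj_pow j (by omega) i (by omega)
    have h2 := circleInt_szego_mul_conj_pow j (by omega) (j - (i + 1)) (by omega)
    -- Reversal turns w^(i+1) into w^(j-(i+1)), up to a conjugation invisible to the real part.
    have h3 : circleInt μ z (fun w => (szego α j w).2 * conj (w ^ (i + 1))) = 0 := by
      rw [← h2]
      refine circleInt_congr hz1 fun w hw => ?_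
      rw [← Complex.conj_re]
      congr 1
      obtain ⟨l, hl⟩ : ∃ l, j = i + 1 + l := ⟨j - (i + 1), by omega⟩
      have h4 : j - (i + 1) = l := by omega
      have h5 : (conj w) ^ (i + 1) * w ^ (i + 1) = 1 := by
        rw [← mul_pow, mul_comm, mul_conj_of_norm_eq_one hw, one_pow]
      rw [szego_snd α hw, h4]
      simp only [map_mul, map_pow, Complex.conj_conj]
      nth_rewrite 1 [hl]
      rw [pow_add]
      linear_combination (conj w) ^ l * (szego α j w).1 * h5
    rw [circleInt_sub hz hz1 (f := fun w => (szego α j w).1 * conj (w ^ i))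
      (g := fun w => (szego α j w).2 * conj (w ^ (i + 1))) (by fun_prop) (by fun_prop) (α j)
      (fun w hw => ?_), h1, h3]
    · simp
    · simp only [szego, map_pow]
      linear_combination (szego α j w).1 * (conj w) ^ i * mul_conj_of_norm_eq_one hw

theorem circleInt_szego_mul_conj_szego {j : ℕ} (hj : j ≤ K) (i : ℕ) : ∀ m, m + i < j →
    circleInt μ z (fun w => (szego α j w).1 * conj (w ^ m * (szego α i w).1)) = 0 ∧
      circleInt μ z (fun w => (szego α j w).1 * conj (w ^ m * (szego α i w).2)) = 0 := by
  induction i with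
  | zero =>
    intro m hm
    simpa [szego] using circleInt_szego_mul_conj_pow hz hz1 hc j hj m hm
  | succ i ih =>
    intro m hm
    have h1 := (ih (m + 1) (by omega)).1
    have h2 := (ih m (by omega)).2
    constructor
    · rw [circleInt_sub hz hz1
        (f := fun w => (szego α j w).1 * conj (w ^ (m + 1) * (szego α i w).1))
        (g := fun w => (szego α j w).1 * conj (w ^ m * (szego α i w).2))
        (by fun_prop) (by fun_prop) (α i) (fun w _ => ?_), h1, h2]
      · simp
      · simp only [szego, map_mul, map_sub, map_pow, Complex.conj_ofReal]
        ring
    · rw [circleInt_sub hz hz1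
        (f := fun w => (szego α j w).1 * conj (w ^ m * (szego α i w).2))
        (g := fun w => (szego α j w).1 * conj (w ^ (m + 1) * (szego α i w).1))
        (by fun_prop) (by fun_prop) (α i) (fun w _ => ?_), h1, h2]
      · simp
      · simp only [szego, map_mul, map_sub, map_pow, Complex.conj_ofReal]
        ring

/-- The reversed polynomial of degree i is 1 minus a combination of w φ_l with l < i, and w φ_j is
orthogonal to each w φ_l. -/
theorem circleInt_mul_szego_mul_conj_snd {j : ℕ} (hj : j ≤ K) : ∀ i ≤ j,
    circleInt μ z (fun w => w * (szego α j w).1 * conj (szego α i w).2) =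
      circleInt μ z (fun w => w ^ 1 * (szego α j w).1)
  | 0, _ => by simp [szego]
  | i + 1, hi => by
    have h1 := (circleInt_szego_mul_conj_szego hz hz1 hc hj i 0 (by omega)).1
    rw [circleInt_sub hz hz1
        (f := fun w => w * (szego α j w).1 * conj (szego α i w).2)
        (g := fun w => (szego α j w).1 * conj (w ^ 0 * (szego α i w).1))
        (by fun_prop) (by fun_prop) (α i) (fun w hw => ?_), h1,
        circleInt_mul_szego_mul_conj_snd hj i (by omega)]
    · simp
    · simp only [szego, map_mul, map_sub, pow_zero, map_one, Complex.conj_ofReal]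
      linear_combination -(α i) * (szego α j w).1 * conj (szego α i w).1 *
        mul_conj_of_norm_eq_one hw

theorem circleInt_szego_self : ∀ j ≤ K,
    circleInt μ z (fun w => (szego α j w).1 * conj (szego α j w).1) = normSq α j
  | 0, _ => by simpa [szego, trigMoment, row, normSq] using hc 0 (by omega)
  | j + 1, hj => by
    have h1 := circleInt_mul_szego_mul_conj_snd hz hz1 hc (j := j) (by omega) j le_rfl
    rw [(circleInt_pow_mul_szego hz hz1 hc j 1 (by omega)).1, row_succ, starRow_row_zero] at h1
    have h2 := circleInt_szego_self j (by omega)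
    have h3 : circleInt μ z (fun w => (szego α j w).2 * conj (szego α (j + 1) w).1) =
        0 + α j * normSq α j - α j * normSq α j := by
      have h4 : circleInt μ z (fun w => (szego α j w).2 * conj (w * (szego α j w).1)) =
          0 + α j * normSq α j := by
        rw [show (0 : ℝ) = row α 0 (j + 1) by simp [row], ← h1]
        refine circleInt_congr hz1 fun w hw => ?_
        rw [← Complex.conj_re]
        congr 1
        simp only [map_mul, Complex.conj_conj]
        ring
      rw [← h4, ← h2]
      refine circleInt_sub hz hz1 (by fun_prop) (by fun_prop) (α j) fun w hw => ?_
      have h5 : (szego α j w).2 * conj (szego α j w).2 =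
          (szego α j w).1 * conj (szego α j w).1 := by
        rw [Complex.mul_conj, Complex.mul_conj, Complex.normSq_eq_norm_sq,
          Complex.normSq_eq_norm_sq, norm_szego_snd α hw]
      simp only [szego, map_mul, map_sub, Complex.conj_ofReal]
      linear_combination -(α j) * h5
    have h6 : circleInt μ z (fun w => w * (szego α j w).1 * conj (szego α (j + 1) w).1) =
        normSq α j - α j * (0 + α j * normSq α j) := by
      rw [show (0 : ℝ) = row α 0 (j + 1) by simp [row], ← h1, ← h2]
      refine circleInt_sub hz hz1 (by fun_prop) (by fun_prop) (α j) fun w hw => ?_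
      simp only [szego, map_mul, map_sub, Complex.conj_ofReal]
      linear_combination (szego α j w).1 * conj (szego α j w).1 * mul_conj_of_norm_eq_one hw
    rw [circleInt_sub hz hz1
        (f := fun w => w * (szego α j w).1 * conj (szego α (j + 1) w).1)
        (g := fun w => (szego α j w).2 * conj (szego α (j + 1) w).1)
        (by fun_prop) (by fun_prop) (α j) (fun w _ => by simp only [szego]; ring), h3, h6,
      normSq_succ]
    ring

/-- The next trigonometric moment of a measure on the circle lies in an interval that is determined
by the Verblunsky coefficients. -/
theorem abs_circleInt_pow_sub_le :
    |circleInt μ z (fun w => w ^ (K + 1)) - trigMoment α (K + 1) + α K * normSq α K| ≤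
      normSq α K := by
  have h1 := circleInt_pow_mul_szego_sub hz hz1 hc K 1 (by omega)
  rw [row_succ, starRow_row_zero, ← circleInt_mul_szego_mul_conj_snd hz hz1 hc le_rfl K le_rfl]
    at h1
  simp only [row, Nat.succ_ne_zero, if_false, zero_add] at h1
  -- The quantity to bound is now the integral of w φ_K times the conjugate of the reversal. Its
  -- modulus is |φ_K|² pointwise, and |φ_K|² integrates to `normSq α K`.
  rw [← h1, sub_add_cancel, ← circleInt_szego_self hz hz1 hc K le_rfl, circleInt, circleInt]
  refine abs_integral_le_integral_abs.trans (integral_mono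
    (integrable_re_comp (f := fun w => w * (szego α K w).1 * conj (szego α K w).2)
      hz hz1 (by fun_prop)).abs
    (integrable_re_comp (f := fun w => (szego α K w).1 * conj (szego α K w).1)
      hz hz1 (by fun_prop)) fun ω => ?_)
  refine (Complex.abs_re_le_norm _).trans ?_
  rw [Complex.mul_conj, Complex.ofReal_re, Complex.normSq_eq_norm_sq, norm_mul, norm_mul, hz1,
    RCLike.norm_conj, norm_szego_snd α (hz1 ω)]
  exact le_of_eq (by ring)

end Circle

/-! ### Transfer from the circle to [a,b] -/

section Interval

/-- The point of the unit circle that lies over the point `x` of the interval with midpoint `h` and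
half-length `r`. -/
noncomputable def circlePoint (h r x : ℝ) : ℂ :=
  Complex.exp ((Real.arccos ((x - h) / r) : ℝ) * Complex.I)

theorem norm_circlePoint (h r x : ℝ) : ‖circlePoint h r x‖ = 1 :=
  Complex.norm_exp_ofReal_mul_I _

theorem measurable_circlePoint (h r : ℝ) : Measurable (circlePoint h r) := by
  have := Real.measurable_arccos
  unfold circlePoint
  fun_prop

theorem circlePoint_pow_re (h r x : ℝ) (k : ℕ) :
    (circlePoint h r x ^ k).re = Real.cos (k * Real.arccos ((x - h) / r)) := by
  rw [circlePoint, ← Complex.exp_nat_mul, ← mul_assoc, ← Complex.ofReal_natCast,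
    ← Complex.ofReal_mul, Complex.exp_ofReal_mul_I_re]

variable {a b : ℝ} {μ : Measure ℝ}

theorem iterate_cosStep_circleInt (hab : a < b) (hμ : μ ∈ momentMeasures (Set.Icc a b)) (k : ℕ) :
    ∀ j, (cosStep ((a + b) / 2) ((b - a) / 2))^[k]
      (fun i => circleInt μ (circlePoint ((a + b) / 2) ((b - a) / 2)) (fun w => w ^ i)) j =
      ∫ x, x ^ k * Real.cos (j * Real.arccos ((x - (a + b) / 2) / ((b - a) / 2))) ∂μ := by
  obtain ⟨_, hμ0, hμi⟩ := hμ
  set h := (a + b) / 2 with hh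
  set r := (b - a) / 2 with hr
  have hr0 : 0 < r := by rw [hr]; linarith
  have hint : ∀ (k j : ℕ),
      Integrable (fun x => x ^ k * Real.cos (j * Real.arccos ((x - h) / r))) μ := by
    intro k j
    have := Real.measurable_arccos
    refine (hμi k).mul_bdd (c := 1) (by fun_prop) (Filter.Eventually.of_forall fun x => ?_)
    exact Real.abs_cos_le_one _
  -- True only on [a,b], since `Real.arccos` is clamped outside [-1,1]; the complement is μ-null.
  have hcos : ∀ᵐ x ∂μ, x = h + r * Real.cos (Real.arccos ((x - h) / r)) := by
    have : ∀ᵐ x ∂μ, x ∈ Set.Icc a b := hμ0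
    filter_upwards [this] with x hx
    rw [Real.cos_arccos]
    · field_simp
      ring
    · rw [le_div_iff₀ hr0]; linarith [hx.1]
    · rw [div_le_iff₀ hr0]; linarith [hx.2]
  induction k with
  | zero => intro j; simp [circleInt, circlePoint_pow_re]
  | succ k ih =>
    intro j
    rw [Function.iterate_succ_apply']
    cases j with
    | zero =>
      rw [cosStep, ih, ih, ← integral_const_mul, ← integral_const_mul,
        ← integral_add ((hint _ _).const_mul _) ((hint _ _).const_mul _)]
      refine integral_congr_ae ?_
      filter_upwards [hcos] with x hx
      simp only [Nat.cast_zero, zero_mul, Real.cos_zero, Nat.cast_one, one_mul]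
      rw [pow_succ]
      linear_combination -x ^ k * hx
    | succ j =>
      have hadd : Integrable (fun x => x ^ k * Real.cos ((j + 2 : ℕ) * Real.arccos ((x - h) / r)) +
          x ^ k * Real.cos (j * Real.arccos ((x - h) / r))) μ := (hint _ _).add (hint _ _)
      rw [cosStep, ih, ih, ih, ← integral_add (hint _ _) (hint _ _), ← integral_const_mul,
        ← integral_const_mul, ← integral_add ((hint _ _).const_mul _) (hadd.const_mul _)]
      refine integral_congr_ae ?_
      filter_upwards [hcos] with x hx
      set θ := Real.arccos ((x - h) / r)
      have h1 : Real.cos (((j + 2 : ℕ) : ℝ) * θ) + Real.cos ((j : ℝ) * θ) =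
          2 * Real.cos (((j + 1 : ℕ) : ℝ) * θ) * Real.cos θ := by
        have e1 : ((j + 2 : ℕ) : ℝ) * θ = ((j + 1 : ℕ) : ℝ) * θ + θ := by push_cast; ring
        have e2 : (j : ℝ) * θ = ((j + 1 : ℕ) : ℝ) * θ - θ := by push_cast; ring
        rw [e1, e2, Real.cos_add, Real.cos_sub]
        ring
      rw [pow_succ]
      linear_combination r / 2 * x ^ k * h1 - x ^ k * Real.cos (((j + 1 : ℕ) : ℝ) * θ) * hx

theorem moment_eq_iterate_cosStep (hab : a < b) (hμ : μ ∈ momentMeasures (Set.Icc a b)) (k : ℕ) :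
    moment μ k = (cosStep ((a + b) / 2) ((b - a) / 2))^[k]
      (fun i => circleInt μ (circlePoint ((a + b) / 2) ((b - a) / 2)) (fun w => w ^ i)) 0 := by
  rw [iterate_cosStep_circleInt hab hμ, moment]
  simp

/-- The range of the moment of order `K + 1` when the moments up to order `K` are given. -/
theorem abs_moment_sub_le (hab : a < b) (hμ : μ ∈ momentMeasures (Set.Icc a b)) {α : ℕ → ℝ} {K : ℕ}
    (H : ∀ k ≤ K, moment μ k =
      (cosStep ((a + b) / 2) ((b - a) / 2))^[k] (trigMoment α) 0) :
    |moment μ (K + 1) - (cosStep ((a + b) / 2) ((b - a) / 2))^[K + 1] (trigMoment α) 0 +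
      2 * ((b - a) / 4) ^ (K + 1) * (α K * normSq α K)| ≤
      2 * ((b - a) / 4) ^ (K + 1) * normSq α K := by
  have := hμ.1
  have hc := eq_of_iterate_cosStep_eq ((a + b) / 2) (r := (b - a) / 2) (by linarith) (K := K)
    (fun k hk => (moment_eq_iterate_cosStep hab hμ k).symm.trans (H k hk))
  have h1 := abs_circleInt_pow_sub_le (measurable_circlePoint _ _) (norm_circlePoint _ _) hc
  rw [moment_eq_iterate_cosStep hab hμ, iterate_cosStep_succ_sub _ _ hc,
    show (b - a) / 2 / 2 = (b - a) / 4 by ring, ← mul_add, abs_mul,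
    abs_of_nonneg (by have : 0 ≤ b - a := by linarith
                      positivity)]
  exact mul_le_mul_of_nonneg_left h1 (by have : 0 ≤ b - a := by linarith
                                         positivity)

end Interval

/-! ### Canonical moments as coordinates on the moment space -/

/-- The Verblunsky coefficients that belong to the canonical moments `p`. -/
noncomputable def verblunsky {n : ℕ} (p : Fin n → ℝ) (j : ℕ) : ℝ :=
  if h : j < n then 2 * p ⟨j, h⟩ - 1 else 1

/-- The ordinary moments as functions of the canonical moments. -/
noncomputable def momentMap (a b : ℝ) {n : ℕ} (p : Fin n → ℝ) (i : Fin n) : ℝ :=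
  (cosStep ((a + b) / 2) ((b - a) / 2))^[i + 1] (trigMoment (verblunsky p)) 0

/-- The length `m_k⁺ - m_k⁻`, `k = i + 1`, as a function of the canonical moments. -/
noncomputable def width (a b : ℝ) {n : ℕ} (p : Fin n → ℝ) (i : Fin n) : ℝ :=
  (b - a) ^ (i + 1 : ℕ) * ∏ j ∈ Finset.Iio i, (p j - p j ^ 2)

variable {a b : ℝ} {n : ℕ} {p q : Fin n → ℝ}

theorem verblunsky_coe (p : Fin n → ℝ) (i : Fin n) : verblunsky p i = 2 * p i - 1 := by
  simp [verblunsky]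

theorem verblunsky_congr {i : ℕ} (h : ∀ j : Fin n, (j : ℕ) < i → p j = q j) :
    ∀ j < i, verblunsky p j = verblunsky q j := by
  intro j hj
  unfold verblunsky
  split_ifs with hjn
  · rw [h ⟨j, hjn⟩ hj]
  · rfl

/-- Since 1 - (2p-1)² = 4p(1-p), the powers of 4 cancel. The left side is twice the radius in
`abs_moment_sub_le`, hence the length of the interval. -/
theorem two_mul_mul_normSq_verblunsky (a b : ℝ) (p : Fin n → ℝ) (i : Fin n) :
    2 * (2 * ((b - a) / 4) ^ (i + 1 : ℕ) * normSq (verblunsky p) i) = width a b p i := by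
  have h1 : normSq (verblunsky p) i = 4 ^ (i : ℕ) * ∏ j ∈ Finset.Iio i, (p j - p j ^ 2) := by
    have h2 : Finset.range i = (Finset.Iio i).map Fin.valEmbedding := by
      rw [Fin.map_valEmbedding_Iio, Nat.Iio_eq_range]
    rw [normSq, h2, Finset.prod_map]
    simp only [Fin.valEmbedding_apply, verblunsky_coe]
    rw [← Fin.card_Iio i, ← Finset.prod_const, ← Finset.prod_mul_distrib]
    exact Finset.prod_congr rfl fun j _ => by ring
  rw [h1, width, div_pow, pow_succ 4]
  field_simp
  ring

theorem momentMap_congr {i : ℕ} (h : ∀ j : Fin n, (j : ℕ) < i → p j = q j) {j : Fin n}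
    (hj : (j : ℕ) < i) : momentMap a b p j = momentMap a b q j :=
  iterate_cosStep_congr _ _ fun _ hk =>
    trigMoment_congr (verblunsky_congr h) (hk.trans hj)

theorem momentMap_sub {i : Fin n} (h : ∀ j < i, p j = q j) :
    momentMap a b p i - momentMap a b q i = (p i - q i) * width a b p i := by
  have h1 := verblunsky_congr (i := i) fun j hj => h j hj
  rw [momentMap, momentMap, iterate_cosStep_succ_sub _ _ fun k hk => trigMoment_congr h1 hk,
    trigMoment_succ_sub h1, verblunsky_coe, verblunsky_coe, ← two_mul_mul_normSq_verblunsky,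
    show (b - a) / 2 / 2 = (b - a) / 4 by ring]
  ring

theorem width_pos (hab : a < b) (hp : ∀ i, p i ∈ Set.Ioo (0 : ℝ) 1) (i : Fin n) :
    0 < width a b p i :=
  mul_pos (pow_pos (sub_pos.2 hab) _) <| Finset.prod_pos fun j _ => by
    have := hp j
    nlinarith [this.1, this.2]

theorem exists_moment_eq_momentMap (hab : a ≤ b) (hp : ∀ i, p i ∈ Set.Icc (0 : ℝ) 1) :
    ∃ μ ∈ momentMeasures (Set.Icc a b), ∀ i : Fin n, moment μ (i + 1) = momentMap a b p i := by
  -- The default value 1 of `verblunsky` past n is what makes the matrix model finite.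
  obtain ⟨μ, hμ, h⟩ := exists_moment_eq (α := verblunsky p) (n := n) (fun i => by
    unfold verblunsky
    split_ifs with hi
    · have := hp ⟨i, hi⟩
      nlinarith [this.1, this.2]
    · simp) (fun i hi => by simp [verblunsky, hi]) hab
  exact ⟨μ, hμ, fun i => h _⟩

theorem mem_Icc_of_mem_possibleMoments (hab : a < b) {i : Fin n} {y : ℝ}
    (hy : y ∈ possibleMoments (Set.Icc a b) (momentMap a b p) i) :
    y ∈ Set.Icc (momentMap a b p i - p i * width a b p i)
      (momentMap a b p i + (1 - p i) * width a b p i) := by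
  obtain ⟨μ, hμ, hm, rfl⟩ := hy
  have := abs_moment_sub_le hab hμ (α := verblunsky p) (K := i) (fun k hk => by
    cases k with
    | zero =>
      have := hμ.1
      simp [moment, trigMoment, row]
    | succ k => exact hm ⟨k, by omega⟩ (Fin.lt_def.2 hk))
  rw [verblunsky_coe] at this
  change |moment μ (i + 1) - momentMap a b p i + _| ≤ _ at this
  have h2 := two_mul_mul_normSq_verblunsky a b p i
  rw [abs_le] at this
  constructor <;> rw [← h2] <;> linarith [this.1, this.2]

/-- Replacing the i-th canonical moment by t keeps the earlier moments and moves the i-th one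
linearly; t = 0 and t = 1 give the extremes. -/
theorem momentMap_add_mem_possibleMoments (hab : a ≤ b) (hp : ∀ i, p i ∈ Set.Icc (0 : ℝ) 1)
    (i : Fin n) {t : ℝ} (ht : t ∈ Set.Icc (0 : ℝ) 1) :
    momentMap a b p i + (t - p i) * width a b p i ∈
      possibleMoments (Set.Icc a b) (momentMap a b p) i := by
  obtain ⟨μ, hμ, h⟩ := exists_moment_eq_momentMap (p := Function.update p i t) hab (fun j => by
    rcases eq_or_ne j i with rfl | hj
    · simpa using ht
    · simpa [hj] using hp j)
  have hq : ∀ j < i, p j = Function.update p i t j := fun j hj => by simp [hj.ne]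
  refine ⟨μ, hμ, fun j hj => ?_, ?_⟩
  · rw [h, momentMap_congr (i := i) (fun j hj => hq j hj) hj]
  · have := momentMap_sub (a := a) (b := b) hq
    rw [h]
    simp only [Function.update_self] at this
    linarith

theorem lowerMoment_momentMap (hab : a < b) (hp : ∀ i, p i ∈ Set.Icc (0 : ℝ) 1) (i : Fin n) :
    lowerMoment (Set.Icc a b) (momentMap a b p) i = momentMap a b p i - p i * width a b p i := by
  have h := momentMap_add_mem_possibleMoments hab.le hp i (t := 0) (by simp)
  rw [zero_sub, neg_mul, ← sub_eq_add_neg] at h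
  exact IsLeast.csInf_eq ⟨h, fun y hy => (mem_Icc_of_mem_possibleMoments hab hy).1⟩

theorem upperMoment_momentMap (hab : a < b) (hp : ∀ i, p i ∈ Set.Icc (0 : ℝ) 1) (i : Fin n) :
    upperMoment (Set.Icc a b) (momentMap a b p) i =
      momentMap a b p i + (1 - p i) * width a b p i :=
  IsGreatest.csSup_eq ⟨momentMap_add_mem_possibleMoments hab.le hp i (by simp),
    fun _ hy => (mem_Icc_of_mem_possibleMoments hab hy).2⟩

theorem canonicalMoment_momentMap (hab : a < b) (hp : ∀ i, p i ∈ Set.Ioo (0 : ℝ) 1) :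
    canonicalMoment (Set.Icc a b) (momentMap a b p) = p := by
  ext i
  have hp' : ∀ i, p i ∈ Set.Icc (0 : ℝ) 1 := fun i => Set.Ioo_subset_Icc_self (hp i)
  rw [canonicalMoment, lowerMoment_momentMap hab hp', upperMoment_momentMap hab hp',
    div_eq_iff]
  · ring
  · have := width_pos hab hp i
    exact ne_of_gt (by linarith)

theorem possibleMoments_congr {T : Set ℝ} {m m' : Fin n → ℝ} {i : Fin n}
    (h : ∀ j < i, m j = m' j) : possibleMoments T m i = possibleMoments T m' i := by
  ext y
  have : ∀ μ : Measure ℝ, (∀ j < i, moment μ (j + 1) = m j) ↔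
      ∀ j < i, moment μ (j + 1) = m' j := fun μ =>
    forall₂_congr fun j hj => by rw [h j hj]
  simp only [possibleMoments, Set.mem_ofPred_eq, this]

/-- The bounds at i depend on earlier coordinates only, so by induction they may be computed from
`momentMap`; p_i then recovers m i from them. -/
theorem momentMap_canonicalMoment (hab : a < b) {m : Fin n → ℝ}
    (hm : ∀ i, lowerMoment (Set.Icc a b) m i < m i ∧ m i < upperMoment (Set.Icc a b) m i) :
    (∀ i, canonicalMoment (Set.Icc a b) m i ∈ Set.Ioo (0 : ℝ) 1) ∧
      momentMap a b (canonicalMoment (Set.Icc a b) m) = m := by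
  have hp : ∀ i, canonicalMoment (Set.Icc a b) m i ∈ Set.Ioo (0 : ℝ) 1 := by
    intro i
    have h1 := (hm i).1
    have h2 := (hm i).2
    exact ⟨div_pos (by linarith) (by linarith), (div_lt_one (by linarith)).2 (by linarith)⟩
  have hp' : ∀ i, canonicalMoment (Set.Icc a b) m i ∈ Set.Icc (0 : ℝ) 1 :=
    fun i => Set.Ioo_subset_Icc_self (hp i)
  refine ⟨hp, funext fun i => ?_⟩
  induction i using WellFoundedLT.induction with
  | _ i ih =>
    have hposs := possibleMoments_congr (T := Set.Icc a b) ih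
    have hl : lowerMoment (Set.Icc a b) m i = _ :=
      (congrArg sInf hposs).symm.trans (lowerMoment_momentMap hab hp' i)
    have hu : upperMoment (Set.Icc a b) m i = _ :=
      (congrArg sSup hposs).symm.trans (upperMoment_momentMap hab hp' i)
    have hlt := (hm i).1.trans (hm i).2
    have h1 : canonicalMoment (Set.Icc a b) m i *
        (upperMoment (Set.Icc a b) m i - lowerMoment (Set.Icc a b) m i) =
        m i - lowerMoment (Set.Icc a b) m i := div_mul_cancel₀ _ (by linarith)
    rw [hu, hl] at h1
    linarith

/-! ### The triangular Jacobian -/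

section Derivative

theorem contDiff_verblunsky (j : ℕ) : ContDiff ℝ 1 fun p : Fin n → ℝ => verblunsky p j := by
  unfold verblunsky
  split_ifs <;> fun_prop

theorem contDiff_starRow {d : (Fin n → ℝ) → ℕ → ℝ} (hd : ∀ j, ContDiff ℝ 1 fun p => d p j) :
    ∀ j, ContDiff ℝ 1 fun p => starRow (verblunsky p) (d p) j
  | 0 => hd 0
  | j + 1 => by
    have h1 := contDiff_verblunsky (n := n) j
    have h2 := contDiff_starRow hd j
    have h3 := hd (j + 1)
    simp only [starRow]
    fun_prop

theorem contDiff_row (k : ℕ) : ∀ j, ContDiff ℝ 1 fun p : Fin n → ℝ => row (verblunsky p) k j := by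
  induction k with
  | zero => exact fun j => contDiff_const
  | succ k ih =>
    intro j
    have h1 := contDiff_verblunsky (n := n) j
    have h2 := contDiff_starRow ih j
    have h3 := ih (j + 1)
    simp only [row_succ]
    fun_prop

theorem contDiff_iterate_cosStep {E : Type*} [NormedAddCommGroup E] [NormedSpace ℝ E] (h r : ℝ)
    {c : E → ℕ → ℝ} (hc : ∀ j, ContDiff ℝ 1 fun p => c p j) (k : ℕ) :
    ∀ j, ContDiff ℝ 1 fun p => (cosStep h r)^[k] (c p) j := by
  induction k with
  | zero => exact hc
  | succ k ih =>
    intro j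
    simp only [Function.iterate_succ_apply']
    cases j with
    | zero =>
      have h1 := ih 0
      have h2 := ih 1
      simp only [cosStep]
      fun_prop
    | succ j =>
      have h1 := ih j
      have h2 := ih (j + 1)
      have h3 := ih (j + 2)
      simp only [cosStep]
      fun_prop

theorem contDiff_momentMap (a b : ℝ) (n : ℕ) :
    ContDiff ℝ 1 (momentMap a b : (Fin n → ℝ) → Fin n → ℝ) :=
  contDiff_pi.2 fun _ => contDiff_iterate_cosStep _ _ (fun j => contDiff_row j 0) _ 0

theorem fderiv_momentMap_single (p : Fin n → ℝ) {i j : Fin n} (hij : i ≤ j) :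
    fderiv ℝ (momentMap a b) p (Pi.single j 1) i = if i = j then width a b p i else 0 := by
  have h1 : HasFDerivAt (momentMap a b) (fderiv ℝ (momentMap a b) p) p :=
    ((contDiff_momentMap a b n).differentiable one_ne_zero p).hasFDerivAt
  have h2 := hasDerivAt_pi.1 (h1.hasLineDerivAt (Pi.single j 1)) i
  refine h2.unique ?_
  -- As i ≤ j, moving along the j-th axis leaves the coordinates before i fixed, so the dependence
  -- on t is exactly affine.
  have h3 : ∀ t : ℝ, momentMap a b (p + t • Pi.single j 1) i =
      momentMap a b p i + t * if i = j then width a b p i else 0 := by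
    intro t
    have h4 := momentMap_sub (a := a) (b := b) (p := p) (q := p + t • Pi.single j 1) (i := i)
      (fun k hk => by simp [(hk.trans_le hij).ne])
    split_ifs with h
    · subst h
      simp only [Pi.add_apply, Pi.smul_apply, Pi.single_eq_same, smul_eq_mul] at h4
      linarith
    · simp only [Pi.add_apply, Pi.smul_apply, Pi.single_eq_of_ne h, smul_eq_mul] at h4
      linarith
  simp only [h3]
  simpa using ((hasDerivAt_id (0 : ℝ)).mul_const
    (if i = j then width a b p i else 0)).const_add (momentMap a b p i)

theorem det_fderiv_momentMap (p : Fin n → ℝ) :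
    (fderiv ℝ (momentMap a b) p).det = ∏ i, width a b p i := by
  rw [ContinuousLinearMap.det, ← LinearMap.det_toMatrix', Matrix.det_of_isLowerTriangular]
  · refine Finset.prod_congr rfl fun i _ => ?_
    simpa [LinearMap.toMatrix'_apply] using fderiv_momentMap_single (a := a) (b := b) p (le_refl i)
  · intro i j hij
    have hij : i < j := hij
    simpa [LinearMap.toMatrix'_apply, hij.ne] using
      fderiv_momentMap_single (a := a) (b := b) p hij.le

/-- The factor p_i - p_i² occurs in the widths of the n - (i + 1) later indices. -/
theorem prod_width (a b : ℝ) (p : Fin n → ℝ) :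
    ∏ i, width a b p i =
      ∏ i : Fin n, (b - a) ^ (i + 1 : ℕ) * (p i - p i ^ 2) ^ (n - (i + 1) : ℕ) := by
  simp only [width, Finset.prod_mul_distrib]
  congr 1
  rw [Finset.prod_comm' (t' := Finset.univ) (s' := fun j => Finset.Ioi j) (by simp)]
  refine Finset.prod_congr rfl fun i _ => ?_
  rw [Finset.prod_const, Fin.card_Ioi]
  congr 1
  omega

/-- The derivative is invertible, so images of neighbourhoods inside the cube are neighbourhoods,
and they consist of moment vectors. -/
theorem momentMap_mem_interior (hab : a < b) (hp : ∀ i, p i ∈ Set.Ioo (0 : ℝ) 1) :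
    momentMap a b p ∈ interior (momentSpace (Set.Icc a b) n) := by
  have h1 : HasStrictFDerivAt (momentMap a b) (fderiv ℝ (momentMap a b) p) p :=
    (contDiff_momentMap a b n).contDiffAt.hasStrictFDerivAt one_ne_zero
  have h2 : (fderiv ℝ (momentMap a b) p).range = ⊤ := by
    rw [← LinearMap.isUnit_iff_range_eq_top, LinearMap.isUnit_iff_isUnit_det, isUnit_iff_ne_zero]
    have h3 : 0 < ∏ i, width a b p i := Finset.prod_pos fun i _ => width_pos hab hp i
    rw [← det_fderiv_momentMap] at h3
    exact h3.ne'
  rw [mem_interior_iff_mem_nhds, ← h1.map_nhds_eq_of_surj h2, Filter.mem_map]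
  have h3 : Set.univ.pi (fun _ : Fin n => Set.Ioo (0 : ℝ) 1) ∈ nhds p :=
    (isOpen_set_pi Set.finite_univ fun _ _ => isOpen_Ioo).mem_nhds fun i _ => hp i
  filter_upwards [h3] with q hq
  obtain ⟨μ, hμ, h⟩ := exists_moment_eq_momentMap (p := q) hab.le
    (fun i => Set.Ioo_subset_Icc_self (hq i trivial))
  exact ⟨μ, hμ, fun i => (h i).symm⟩

end Derivative

/-! ### Product densities and the one-dimensional laws -/

/-- A product of measures with non-negative integrable densities has the product density. -/
theorem pi_withDensity_ofReal {ι : Type*} [Fintype ι] {g : ι → ℝ → ℝ} (hg0 : ∀ i x, 0 ≤ g i x)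
    (hg : ∀ i, Integrable (g i)) :
    Measure.pi (fun i => volume.withDensity fun x => ENNReal.ofReal (g i x)) =
      volume.withDensity fun p : ι → ℝ => ENNReal.ofReal (∏ i, g i (p i)) := by
  classical
  have := fun i => isFiniteMeasure_withDensity_ofReal (hg i).2
  refine Measure.pi_eq fun S hS => ?_
  have h1 : ∀ p : ι → ℝ, (Set.univ.pi S).indicator
      (fun p => ENNReal.ofReal (∏ i, g i (p i))) p =
      ENNReal.ofReal (∏ i, (S i).indicator (g i) (p i)) := by
    intro p
    by_cases hp : p ∈ Set.univ.pi S
    · rw [Set.indicator_of_mem hp]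
      exact congrArg _ (Finset.prod_congr rfl fun i _ =>
        (Set.indicator_of_mem (hp i trivial) _).symm)
    · rw [Set.indicator_of_notMem hp]
      simp only [Set.mem_univ_pi, not_forall] at hp
      obtain ⟨i, hi⟩ := hp
      rw [Finset.prod_eq_zero (Finset.mem_univ i) (Set.indicator_of_notMem hi _),
        ENNReal.ofReal_zero]
  have h0 : ∀ i x, 0 ≤ (S i).indicator (g i) x := fun i x =>
    Set.indicator_nonneg (fun x _ => hg0 i x) x
  have hint : ∀ i, Integrable ((S i).indicator (g i)) := fun i => (hg i).indicator (hS i)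
  rw [withDensity_apply _ (MeasurableSet.univ_pi hS), ← lintegral_indicator
    (MeasurableSet.univ_pi hS)]
  simp only [h1]
  rw [volume_pi, ← ofReal_integral_eq_lintegral_ofReal (Integrable.fintype_prod hint)
    (Filter.Eventually.of_forall fun p => Finset.prod_nonneg fun i _ => h0 i _),
    integral_fintype_prod_eq_prod,
    ENNReal.ofReal_prod_of_nonneg fun i _ => integral_nonneg (h0 i)]
  refine Finset.prod_congr rfl fun i _ => ?_
  rw [withDensity_apply _ (hS i), integral_indicator (hS i),
    ofReal_integral_eq_lintegral_ofReal (hg i).integrableOn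
      (Filter.Eventually.of_forall fun x => hg0 i x)]

section Density

variable {a b : ℝ} {n : ℕ} {f : ℕ → ℝ → ℝ} {k : ℕ}

theorem integrableOn_mul_pow {f : ℝ → ℝ} (hf : IntegrableOn f (Set.Ioo 0 1)) (l : ℕ) :
    IntegrableOn (fun x => f x * (x - x ^ 2) ^ l) (Set.Ioo 0 1) := by
  refine Integrable.mul_bdd (c := 1) hf (by fun_prop) ?_
  filter_upwards [ae_restrict_mem measurableSet_Ioo] with x hx
  rw [norm_pow]
  refine pow_le_one₀ (norm_nonneg _) ?_
  rw [Real.norm_eq_abs, abs_le]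
  constructor <;> nlinarith [hx.1, hx.2]

/-- The weight is positive on (0,1), so multiplying by it does not change the support there. -/
theorem setIntegral_mul_pow_pos {f : ℝ → ℝ} (hf0 : ∀ x ∈ Set.Ioo (0 : ℝ) 1, 0 ≤ f x)
    (hf : IntegrableOn f (Set.Ioo 0 1)) (hpos : 0 < ∫ x in Set.Ioo (0 : ℝ) 1, f x) (l : ℕ) :
    0 < ∫ x in Set.Ioo (0 : ℝ) 1, f x * (x - x ^ 2) ^ l := by
  have hw : ∀ x ∈ Set.Ioo (0 : ℝ) 1, 0 < (x - x ^ 2) ^ l := fun x hx =>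
    pow_pos (by nlinarith [hx.1, hx.2]) l
  have h0 : 0 ≤ᵐ[volume.restrict (Set.Ioo (0 : ℝ) 1)] f := by
    filter_upwards [ae_restrict_mem measurableSet_Ioo] with x hx using hf0 x hx
  have h1 : 0 ≤ᵐ[volume.restrict (Set.Ioo (0 : ℝ) 1)] fun x => f x * (x - x ^ 2) ^ l := by
    filter_upwards [ae_restrict_mem measurableSet_Ioo] with x hx using
      mul_nonneg (hf0 x hx) (hw x hx).le
  rw [setIntegral_pos_iff_support_of_nonneg_ae h1 (integrableOn_mul_pow hf l)]
  rw [setIntegral_pos_iff_support_of_nonneg_ae h0 hf] at hpos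
  convert! hpos using 2
  ext x
  simp only [Set.mem_inter_iff, Function.mem_support, mul_ne_zero_iff]
  exact ⟨fun h => ⟨h.1.1, h.2⟩, fun h => ⟨⟨h.1, (hw x h.2).ne'⟩, h.2⟩⟩

theorem canonicalDensity_nonneg (hab : a < b) (hf0 : ∀ x ∈ Set.Ioo (0 : ℝ) 1, 0 ≤ f k x) (x : ℝ) :
    0 ≤ canonicalDensity a b n f k x := by
  have hba : 0 < b - a := sub_pos.2 hab
  have hw : ∀ x ∈ Set.Ioo (0 : ℝ) 1, 0 ≤ (x - x ^ 2) ^ (n - k) := fun x hx =>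
    pow_nonneg (by nlinarith [hx.1, hx.2]) _
  refine Set.indicator_nonneg (fun x hx => ?_) x
  have h1 : 0 ≤ normConst a b n f k := inv_nonneg.2 <| mul_nonneg (by positivity) <|
    setIntegral_nonneg measurableSet_Ioo fun x hx => mul_nonneg (hf0 x hx) (hw x hx)
  have := hf0 x hx
  have := hw x hx
  positivity

theorem integrable_canonicalDensity (hf : IntegrableOn (f k) (Set.Ioo 0 1)) :
    Integrable (canonicalDensity a b n f k) := by
  rw [canonicalDensity, integrable_indicator_iff measurableSet_Ioo]
  refine ((integrableOn_mul_pow hf (n - k)).const_mul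
    (normConst a b n f k * (b - a) ^ k)).congr (Filter.Eventually.of_forall fun x => ?_)
  simp only
  ring

theorem integral_canonicalDensity (hab : a < b) (hf0 : ∀ x ∈ Set.Ioo (0 : ℝ) 1, 0 ≤ f k x)
    (hf : IntegrableOn (f k) (Set.Ioo 0 1)) (hpos : 0 < ∫ x in Set.Ioo (0 : ℝ) 1, f k x) :
    ∫ x, canonicalDensity a b n f k x = 1 := by
  have h1 := setIntegral_mul_pow_pos hf0 hf hpos (n - k)
  have h2 : 0 < (b - a) ^ k := pow_pos (sub_pos.2 hab) k
  rw [canonicalDensity, integral_indicator measurableSet_Ioo]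
  simp only [mul_assoc]
  rw [integral_const_mul, integral_const_mul, normConst]
  exact inv_mul_cancel₀ (mul_pos h2 h1).ne'

/-- The law of the canonical moment of order `k`. -/
noncomputable def canonicalLaw (a b : ℝ) (n : ℕ) (f : ℕ → ℝ → ℝ) (k : ℕ) : Measure ℝ :=
  volume.withDensity fun x => ENNReal.ofReal (canonicalDensity a b n f k x)

theorem isProbabilityMeasure_canonicalLaw (hab : a < b)
    (hf0 : ∀ x ∈ Set.Ioo (0 : ℝ) 1, 0 ≤ f k x)
    (hf : IntegrableOn (f k) (Set.Ioo 0 1)) (hpos : 0 < ∫ x in Set.Ioo (0 : ℝ) 1, f k x) :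
    IsProbabilityMeasure (canonicalLaw a b n f k) := by
  constructor
  rw [canonicalLaw, withDensity_apply _ MeasurableSet.univ, Measure.restrict_univ,
    ← ofReal_integral_eq_lintegral_ofReal (integrable_canonicalDensity hf)
      (Filter.Eventually.of_forall (canonicalDensity_nonneg hab hf0)),
    integral_canonicalDensity hab hf0 hf hpos, ENNReal.ofReal_one]

theorem canonicalLaw_ae_mem (a b : ℝ) (n : ℕ) (f : ℕ → ℝ → ℝ) (k : ℕ) :
    ∀ᵐ x ∂(canonicalLaw a b n f k), x ∈ Set.Ioo (0 : ℝ) 1 := by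
  change canonicalLaw a b n f k (Set.Ioo 0 1)ᶜ = 0
  rw [canonicalLaw, withDensity_apply _ measurableSet_Ioo.compl]
  refine (setLIntegral_congr_fun measurableSet_Ioo.compl fun x hx => ?_).trans lintegral_zero
  rw [canonicalDensity, Set.indicator_of_notMem hx, ENNReal.ofReal_zero]

end Density

/-! ### Change of variables and the law of the canonical moments -/

section Law

variable {a b : ℝ} {n : ℕ} {f : ℕ → ℝ → ℝ}

/-- The open unit cube, in which the canonical moments vary. -/
def openCube (n : ℕ) : Set (Fin n → ℝ) := Set.univ.pi fun _ => Set.Ioo 0 1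

theorem measurableSet_openCube (n : ℕ) : MeasurableSet (openCube n) :=
  MeasurableSet.univ_pi fun _ => measurableSet_Ioo

theorem injOn_momentMap (hab : a < b) : Set.InjOn (momentMap a b) (openCube n) :=
  fun p hp q hq h => by
    rw [← canonicalMoment_momentMap hab (p := p) fun i => hp i trivial, h,
      canonicalMoment_momentMap hab (p := q) fun i => hq i trivial]

theorem measurableEmbedding_momentMap (hab : a < b) :
    MeasurableEmbedding ((openCube n).domRestrict (momentMap a b)) :=
  (contDiff_momentMap a b n).continuous.continuousOn.measurableEmbedding
    (measurableSet_openCube n) (injOn_momentMap hab)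

theorem momentDensity_momentMap (hab : a < b) {p : Fin n → ℝ} (hp : p ∈ openCube n) :
    |(fderiv ℝ (momentMap a b) p).det| * momentDensity a b n f (momentMap a b p) =
      ∏ i : Fin n, canonicalDensity a b n f (i + 1) (p i) := by
  have hp1 : ∀ i, p i ∈ Set.Ioo (0 : ℝ) 1 := fun i => hp i trivial
  have hp2 : ∀ i, p i ∈ Set.Icc (0 : ℝ) 1 := fun i => Set.Ioo_subset_Icc_self (hp1 i)
  have hw := width_pos hab hp1
  rw [det_fderiv_momentMap, abs_of_pos (Finset.prod_pos fun i _ => hw i), prod_width,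
    momentDensity, ← Finset.prod_mul_distrib]
  refine Finset.prod_congr rfl fun i _ => ?_
  rw [lowerMoment_momentMap hab hp2, upperMoment_momentMap hab hp2,
    canonicalMoment_momentMap hab hp1, if_pos, canonicalDensity, Set.indicator_of_mem (hp1 i)]
  · ring
  · have := hp1 i
    constructor <;> nlinarith [this.1, this.2, hw i]

theorem momentDensity_eq_zero (hab : a < b) {m : Fin n → ℝ}
    (hm : m ∉ momentMap a b '' openCube n) : momentDensity a b n f m = 0 := by
  by_contra h
  refine hm ?_
  have h1 : ∀ i, lowerMoment (Set.Icc a b) m i < m i ∧ m i < upperMoment (Set.Icc a b) m i := by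
    intro i
    by_contra hi
    exact h (Finset.prod_eq_zero (Finset.mem_univ i) (by rw [if_neg hi, mul_zero]))
  obtain ⟨h2, h3⟩ := momentMap_canonicalMoment hab h1
  exact ⟨_, fun i _ => h2 i, h3⟩

/-- The law with density `f_n` is the image of the product of the laws of the canonical moments. -/
theorem momentLaw_eq_map (hab : a < b)
    (hf0 : ∀ k, 1 ≤ k → k ≤ n → ∀ x ∈ Set.Ioo (0 : ℝ) 1, 0 ≤ f k x)
    (hf : ∀ k, 1 ≤ k → k ≤ n → IntegrableOn (f k) (Set.Ioo (0 : ℝ) 1)) :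
    momentLaw a b n f =
      (Measure.pi fun i : Fin n => canonicalLaw a b n f (i + 1)).map (momentMap a b) := by
  have hmeas : Measurable (momentMap a b : (Fin n → ℝ) → Fin n → ℝ) :=
    (contDiff_momentMap a b n).continuous.measurable
  have hpi := pi_withDensity_ofReal (g := fun i : Fin n => canonicalDensity a b n f (i + 1))
    (fun i => canonicalDensity_nonneg hab (hf0 _ (by omega) (by omega)))
    (fun i => integrable_canonicalDensity (hf _ (by omega) (by omega)))
  ext B hB
  rw [Measure.map_apply hmeas hB]
  unfold canonicalLaw
  -- The two densities vanish off the image of the cube and off the cube, so both integrals restrict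
  -- to sets between which `momentMap` is injective.
  rw [hpi, momentLaw, withDensity_apply _ hB, withDensity_apply _ (hmeas hB),
    ← lintegral_indicator hB, ← lintegral_indicator (hmeas hB),
    ← setLIntegral_eq_of_support_subset (s := momentMap a b '' openCube n)
      (f := B.indicator fun m => ENNReal.ofReal (momentDensity a b n f m)),
    ← setLIntegral_eq_of_support_subset (s := openCube n)
      (f := (momentMap a b ⁻¹' B).indicator fun p => ENNReal.ofReal
        (∏ i : Fin n, canonicalDensity a b n f (i + 1) (p i))),
    lintegral_image_eq_lintegral_abs_det_fderiv_mul volume (measurableSet_openCube n)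
      (fun p _ => ((contDiff_momentMap a b n).differentiable one_ne_zero
        p).hasFDerivAt.hasFDerivWithinAt) (injOn_momentMap hab)]
  · refine setLIntegral_congr_fun (measurableSet_openCube n) fun p hp => ?_
    by_cases hpB : momentMap a b p ∈ B
    · rw [Set.indicator_of_mem hpB, Set.indicator_of_mem (Set.mem_preimage.2 hpB),
        ← ENNReal.ofReal_mul (abs_nonneg _), momentDensity_momentMap hab hp]
    · rw [Set.indicator_of_notMem hpB, Set.indicator_of_notMem (s := momentMap a b ⁻¹' B) hpB,
        mul_zero]
  · refine Function.support_subset_iff'.2 fun p hp => ?_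
    refine Set.indicator_apply_eq_zero.2 fun _ => ?_
    simp only [openCube, Set.mem_univ_pi, not_forall] at hp
    obtain ⟨i, hi⟩ := hp
    rw [Finset.prod_eq_zero (Finset.mem_univ i) (by
      rw [canonicalDensity, Set.indicator_of_notMem hi]), ENNReal.ofReal_zero]
  · refine Function.support_subset_iff'.2 fun m hm => ?_
    refine Set.indicator_apply_eq_zero.2 fun _ => ?_
    rw [momentDensity_eq_zero hab hm, ENNReal.ofReal_zero]

/-- Measurability of `canonicalMoment` is not evident from its infima and suprema. It agrees almost
everywhere with a measurable extension g of the inverse of `momentMap` on the cube. -/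
theorem hasLaw_canonicalMoment (hab : a < b) {π : Measure (Fin n → ℝ)}
    (hπ : ∀ᵐ p ∂π, p ∈ openCube n) :
    HasLaw (canonicalMoment (Set.Icc a b)) π (π.map (momentMap a b)) := by
  have hmeas : Measurable (momentMap a b : (Fin n → ℝ) → Fin n → ℝ) :=
    (contDiff_momentMap a b n).continuous.measurable
  have hemb := measurableEmbedding_momentMap (n := n) hab
  obtain ⟨g, hg, hgm⟩ := hemb.exists_measurable_extend (g := fun p => (p : Fin n → ℝ))
    measurable_subtype_coe fun p => ⟨p⟩
  have hgm' : ∀ p ∈ openCube n, g (momentMap a b p) = p := fun p hp => congrFun hgm ⟨p, hp⟩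
  have hae : g =ᵐ[π.map (momentMap a b)] canonicalMoment (Set.Icc a b) := by
    have h1 : ∀ᵐ m ∂(π.map (momentMap a b)),
        m ∈ Set.range ((openCube n).domRestrict (momentMap a b)) := by
      refine (ae_map_iff (p := (· ∈ Set.range ((openCube n).domRestrict (momentMap a b))))
        hmeas.aemeasurable hemb.measurableSet_range).2 ?_
      filter_upwards [hπ] with p hp using ⟨⟨p, hp⟩, rfl⟩
    filter_upwards [h1] with m hm
    obtain ⟨⟨p, hp⟩, rfl⟩ := hm
    exact (hgm' p hp).trans (canonicalMoment_momentMap hab fun i => hp i trivial).symm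
  refine ⟨hg.aemeasurable.congr hae, ?_⟩
  rw [← Measure.map_congr hae, Measure.map_map hg hmeas]
  refine (Measure.map_congr (g := id) ?_).trans Measure.map_id
  filter_upwards [hπ] with p hp using hgm' p hp

end Law

end CanonicalMoments

theorem mainTheorem3 (a b : ℝ) (hab : a < b) (n : ℕ) (f : ℕ → ℝ → ℝ)
    (hf_nonneg : ∀ k, 1 ≤ k → k ≤ n → ∀ x ∈ Set.Ioo (0 : ℝ) 1, 0 ≤ f k x)
    (hf_int : ∀ k, 1 ≤ k → k ≤ n → IntegrableOn (f k) (Set.Ioo (0 : ℝ) 1))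
    (hf_pos : ∀ k, 1 ≤ k → k ≤ n → 0 < ∫ x in Set.Ioo (0 : ℝ) 1, f k x) :
    -- `f_n` is a probability density on the interior of the moment space
    (IsProbabilityMeasure (CanonicalMoments.momentLaw a b n f) ∧
      ∀ᵐ m ∂(CanonicalMoments.momentLaw a b n f),
        m ∈ interior (CanonicalMoments.momentSpace (Set.Icc a b) n)) ∧
    -- the canonical moments of a random vector with density `f_n`
    ∀ {Ω : Type*} [MeasurableSpace Ω] (P : Measure Ω) [IsProbabilityMeasure P]
      (X : Ω → Fin n → ℝ), HasLaw X (CanonicalMoments.momentLaw a b n f) P →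
      iIndepFun (fun (i : Fin n) (ω : Ω) =>
        CanonicalMoments.canonicalMoment (Set.Icc a b) (X ω) i) P ∧
      ∀ i : Fin n,
        HasLaw (fun ω => CanonicalMoments.canonicalMoment (Set.Icc a b) (X ω) i)
          (volume.withDensity fun x =>
            ENNReal.ofReal (CanonicalMoments.canonicalDensity a b n f (i + 1) x)) P := by
  have hprob : ∀ i : Fin n,
      IsProbabilityMeasure (CanonicalMoments.canonicalLaw a b n f (i + 1)) := fun i =>
    CanonicalMoments.isProbabilityMeasure_canonicalLaw hab (hf_nonneg _ (by omega) (by omega))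
      (hf_int _ (by omega) (by omega)) (hf_pos _ (by omega) (by omega))
  have hmeas : Measurable (CanonicalMoments.momentMap a b : (Fin n → ℝ) → Fin n → ℝ) :=
    (CanonicalMoments.contDiff_momentMap a b n).continuous.measurable
  rw [CanonicalMoments.momentLaw_eq_map hab hf_nonneg hf_int]
  set π := Measure.pi fun i : Fin n => CanonicalMoments.canonicalLaw a b n f (i + 1) with hπ
  have hcube : ∀ᵐ p ∂π, p ∈ CanonicalMoments.openCube n := by
    have h1 : ∀ᵐ p ∂π, ∀ i, p i ∈ Set.Ioo (0 : ℝ) 1 := ae_all_iff.2 fun i =>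
      (Measure.quasiMeasurePreserving_eval _ i).ae
        (CanonicalMoments.canonicalLaw_ae_mem a b n f (i + 1))
    filter_upwards [h1] with p hp i _ using hp i
  refine ⟨⟨Measure.isProbabilityMeasure_map hmeas.aemeasurable, ?_⟩, ?_⟩
  · refine (ae_map_iff
      (p := (· ∈ interior (CanonicalMoments.momentSpace (Set.Icc a b) n)))
      hmeas.aemeasurable isOpen_interior.measurableSet).2 ?_
    filter_upwards [hcube] with p hp using
      CanonicalMoments.momentMap_mem_interior hab fun i => hp i trivial
  · intro Ω _ P _ X hX
    have hY := (CanonicalMoments.hasLaw_canonicalMoment hab hcube).fun_comp hX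
    have hYi : ∀ i : Fin n,
        HasLaw (fun ω => CanonicalMoments.canonicalMoment (Set.Icc a b) (X ω) i)
          (CanonicalMoments.canonicalLaw a b n f (i + 1)) P := fun i =>
      (measurePreserving_eval _ i).hasLaw.fun_comp hY
    -- The joint law is the product of the marginals, which is independence.
    exact ⟨(iIndepFun_iff_hasLaw_pi_pi hYi).2 hY, hYi⟩
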